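/- Let $k\ge 1$ be fixed and let $n\ge k$. The input is a uniformly random permutation $(e_1,\dots,e_n)$ of $\{1,\dots,n\}$; the pivots $p_1<\dots<p_k$ are $e_1,\dots,e_k$ in sorted order, $p_0=0$, $p_{k+1}=n+1$. A non-pivot $x$ belongs to group $\mathrm A_h$ ($0\le h\le k$) if $p_h<x<p_{h+1}$, and $a_h=p_{h+1}-p_h-1$ is the size of $\mathrm A_h$. A comparison tree $\lambda$ is a binary search tree with inner nodes $\mathrm p_1,\dots,\mathrm p_k$ in inorder and leaves $\mathrm A_0,\dots,\mathrm A_k$ from left to right; it classifies an element of $\mathrm A_h$ with $\mathrm{depth}_\lambda(\mathrm A_h)$ comparisons, and $\mathrm{cost}^\lambda(b_0,\dots,b_k)=\sum_{h=0}^k \mathrm{depth}_\lambda(\mathrm A_h)\,b_h$. A classification tree is a $(k+1)$-way tree in which every inner node $v$ carries an index $i(v)\in\{k+1,\dots,n\}$ and a comparison tree $\lambda(v)$, the edges out of $v$ are labeled $0,\dots,k$, and each index in $\{k+1,\dots,n\}$ occurs exactly once on every path from the root to a leaf; at $v$ the element $e_{i(v)}$ is classified with $\lambda(v)$, and the edge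 labeled by its group is followed. Let $a^v_h$ be the number of edges labeled $h$ on the path from the root to $v$. A classification strategy assigns to all group sizes $(a_0,\dots,a_k)$ with $a_0+\dots+a_k=n-k$ a classification tree. Its average comparison count is the expected number of comparisons made when classifying the $n-k$ non-pivots, where the classification tree assigned to the group sizes of the input is used. Strategy $\mathcal O_k$ uses at every node $v$ a comparison tree $\lambda(v)$ that minimizes $\mathrm{cost}^{\lambda}(a_0-a_0^v,\dots,a_k-a_k^v)$ over all comparison trees $\lambda$. Strategy $\mathcal N_k$ uses at every node a comparison tree that minimizes $\mathrm{cost}^{\lambda}(a_0,\dots,a_k)$ over all comparison trees $\lambda$ (for instance, one fixed minimizer for all classifications). In both strategies the order in which the elements are classified, and the choice among several minimizers, are arbitrary. **Theorem.** For each $k\ge1$, strategy $\mathcal N_k$ is asymptotically optimal. That is, there are constants $\varepsilon>0$ and $C$, depending only on $k$, such that for every $n\ge k$ the average comparison count of $\mathcal N_k$ differs from that of the optimal strategy $\mathcal O_k$ by at most $C\,n^{1-\varepsilon}$, and it is at most $C\,n^{1-\varepsilon}$ larger than the average comparison count of any classification strategy for inputs of length $n$. -/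

import Mathlib

namespace MultiPivot

/-- A comparison tree for `k` pivots: a binary tree with `k` inner nodes, hence `k + 1` leaves.
The labels are forced by the shape: the inner nodes are `p_1, …, p_k` in inorder and the leaves are
`A_0, …, A_k` from left to right. -/
abbrev ComparisonTree (k : ℕ) : Type := {t : BinaryTree Unit // t.numNodes = k}

/-- The depth of the leaf number `h` (counted from the left, starting with `0`). -/
def leafDepth : BinaryTree Unit → ℕ → ℕ
  | .nil, _ => 0
  | .node _ l r, h =>
      1 + if h < l.numLeaves then leafDepth l h else leafDepth r (h - l.numLeaves)

/-- `depth_λ(A_h)`: the number of comparisons that the comparison tree `t` makes for an element of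
the group `A_h`. -/
def ComparisonTree.depth {k : ℕ} (t : ComparisonTree k) (h : Fin (k + 1)) : ℕ :=
  leafDepth t.1 h

/-- The cost `cost^λ(b_0, …, b_k) = ∑ h, depth_λ(A_h) * b_h` of a comparison tree. -/
def ComparisonTree.cost {k : ℕ} (t : ComparisonTree k) (b : Fin (k + 1) → ℤ) : ℤ :=
  ∑ h, (t.depth h : ℤ) * b h

/-- `t` has minimum cost with respect to `b_0, …, b_k` among all comparison trees. -/
def ComparisonTree.IsMinCost {k : ℕ} (t : ComparisonTree k) (b : Fin (k + 1) → ℤ) : Prop :=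
  ∀ t' : ComparisonTree k, t.cost b ≤ t'.cost b

/-- Classification trees: an inner node `v` carries an index `i(v)`, a comparison tree `λ(v)`, and
`k + 1` children, one for each possible outcome `A_0, …, A_k` of classifying the element with
index `i(v)`. Positions in the input are `0, …, n - 1`. -/
inductive ClassificationTree (k n : ℕ) : Type
  | leaf : ClassificationTree k n
  | node (i : Fin n) (t : ComparisonTree k)
      (child : Fin (k + 1) → ClassificationTree k n) : ClassificationTree k n

/-- On every path from the root to a leaf, each index from `s` occurs exactly once, and no other
index occurs. (So all paths have exactly `s.card` inner nodes.) -/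
def ClassificationTree.Classifies {k n : ℕ} : ClassificationTree k n → Finset (Fin n) → Prop
  | .leaf, s => s = ∅
  | .node i _ child, s => i ∈ s ∧ ∀ h, (child h).Classifies (s.erase i)

/-- `P` holds at every inner node `v` for the comparison tree `λ(v)` and the vector of the numbers
`a^v_h` of edges labeled `h` on the path from the root to `v`; here `u` is the vector at the root
of the given tree, which is `0` for a full classification tree. -/
def ClassificationTree.EveryNode {k n : ℕ} (P : ComparisonTree k → (Fin (k + 1) → ℕ) → Prop) :
    ClassificationTree k n → (Fin (k + 1) → ℕ) → Prop
  | .leaf, _ => True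
  | .node _ t child, u => P t u ∧ ∀ h, (child h).EveryNode P (u + Pi.single h 1)

/-- The number of comparisons made along the path that an input takes in a classification tree,
where `g i` is the group of the input element with index `i`. -/
def ClassificationTree.comparisons {k n : ℕ} (g : Fin n → Fin (k + 1)) :
    ClassificationTree k n → ℕ
  | .leaf => 0
  | .node i t child => t.depth (g i) + (child (g i)).comparisons g

/-- The indices of the non-pivots; the pivots are the first `k` elements of the input. -/
def nonPivots (k n : ℕ) : Finset (Fin n) := Finset.univ.filter fun i => k ≤ (i : ℕ)

/-- The pivots with value below the element with index `i`, for the input `σ 0, …, σ (n - 1)`. -/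
def pivotsBelow {n : ℕ} (k : ℕ) (σ : Equiv.Perm (Fin n)) (i : Fin n) : Finset (Fin n) :=
  Finset.univ.filter fun j => (j : ℕ) < k ∧ σ j < σ i

theorem card_pivotsBelow_lt {n : ℕ} (k : ℕ) (σ : Equiv.Perm (Fin n)) (i : Fin n) :
    (pivotsBelow k σ i).card < k + 1 := by
  have h : (pivotsBelow k σ i).card ≤ (Finset.range k).card :=
    Finset.card_le_card_of_injOn (fun j => (j : ℕ))
      (fun j hj => by
        have hj' : (j : ℕ) < k ∧ σ j < σ i := by simpa [pivotsBelow] using hj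
        simpa using hj'.1)
      (fun a _ b _ hab => Fin.ext hab)
  rw [Finset.card_range] at h
  omega

/-- The group of the element with index `i` in the input `σ`: a non-pivot `x` belongs to `A_h`,
that is `p_h < x < p_(h+1)`, exactly if `h` of the pivots are smaller than `x`. -/
def group {n : ℕ} (k : ℕ) (σ : Equiv.Perm (Fin n)) (i : Fin n) : Fin (k + 1) :=
  ⟨(pivotsBelow k σ i).card, card_pivotsBelow_lt k σ i⟩

/-- The group sizes `a_0, …, a_k` of the input `σ`. -/
def groupSizes {n : ℕ} (k : ℕ) (σ : Equiv.Perm (Fin n)) : Fin (k + 1) → ℕ := fun h =>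
  ((nonPivots k n).filter fun i => group k σ i = h).card

/-- A classification strategy for inputs of length `n`, which may know the group sizes
`a_0, …, a_k` (equivalently, the pivots `p_1, …, p_k`) in advance: a classification tree for each
vector of group sizes. -/
structure Strategy (k n : ℕ) where
  /-- The classification tree that is used for given group sizes. -/
  tree : (Fin (k + 1) → ℕ) → ClassificationTree k n
  classifies : ∀ a, (tree a).Classifies (nonPivots k n)

/-- The average comparison count `E(P_n)` for partitioning: the number of comparisons that are made
when classifying the non-pivots, averaged over all permutations of the input. -/
noncomputable def Strategy.averageCount {k n : ℕ} (S : Strategy k n) : ℝ :=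
  (∑ σ : Equiv.Perm (Fin n), ((S.tree (groupSizes k σ)).comparisons (group k σ) : ℝ)) /
    (n.factorial : ℝ)

/-- Strategy `O_k`: for given group sizes `a`, the comparison tree used at a node `v` minimizes the
cost with respect to the sizes `a_h - a^v_h` of the groups in the unclassified part of the input.
The order of classification and the choice among several minimizers are free. -/
def Strategy.IsO {k n : ℕ} (S : Strategy k n) : Prop :=
  ∀ a : Fin (k + 1) → ℕ, ∑ h, a h + k = n →
    (S.tree a).EveryNode (fun t u => t.IsMinCost fun h => (a h : ℤ) - (u h : ℤ)) 0

/-- Strategy `N_k`: for given group sizes `a`, the comparison tree used at every node minimizes the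
cost with respect to the full group sizes `a`. The order of classification and the choice among
several minimizers are free; in particular one fixed minimizer may be used at all nodes. -/
def Strategy.IsN {k n : ℕ} (S : Strategy k n) : Prop :=
  ∀ a : Fin (k + 1) → ℕ, ∑ h, a h + k = n →
    (S.tree a).EveryNode (fun t _ => t.IsMinCost fun h => (a h : ℤ)) 0

end MultiPivot

namespace MultiPivot

open Finset

/-! Conditioned on the group sizes, the sequence of groups of the non-pivots is exchangeable. So the
mean cost of a classification tree satisfies the recursion `expected` for drawing groups without
replacement (`Exchangeable.sum_comparisons`), and it suffices to compare trees for fixed group sizes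
(`averageCount_le_add`). The law of the remaining sizes `b` depends neither on the order of
classification nor on the comparison trees. Hence minimizing the cost at each node separately is
optimal, which is strategy `O_k`. For `N_k`, put `p = a / m` with `m` the number of non-pivots. A
minimizer for `p` loses at sizes `b` at most a multiple of the deviation of `b` from its multiple of
`p`. This deviation is zero at the root and stays small in mean square, which a potential argument
turns into a bound on the total loss (`expected_le_add`). -/

/-! ### Depth bound and expected comparison counts -/

theorem leafDepth_le_numNodes (t : BinaryTree Unit) (h : ℕ) : leafDepth t h ≤ t.numNodes := by
  induction t generalizing h with
  | nil => simp [leafDepth]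
  | node _ l r ihl ihr =>
    simp only [leafDepth, BinaryTree.numNodes]
    split_ifs
    · have := ihl h
      omega
    · have := ihr (h - l.numLeaves)
      omega

theorem ComparisonTree.depth_le {k : ℕ} (t : ComparisonTree k) (h : Fin (k + 1)) :
    t.depth h ≤ k :=
  (leafDepth_le_numNodes t.1 h).trans t.2.le

/-- The expected number of comparisons in a classification tree when the sequence of groups is
uniformly distributed over all sequences with `b h` members of `A_h`. -/
noncomputable def ClassificationTree.expected {k n : ℕ} :
    ClassificationTree k n → (Fin (k + 1) → ℕ) → ℝ
  | .leaf, _ => 0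
  | .node _ t child, b =>
      (∑ h, (b h : ℝ) * (t.depth h + (child h).expected (b - Pi.single h 1))) / ∑ h, (b h : ℝ)

theorem sum_sub_single {ι : Type*} [Fintype ι] [DecidableEq ι] {b : ι → ℕ} {h : ι} {m : ℕ}
    (hb : ∑ j, b j = m + 1) (hh : b h ≠ 0) : ∑ j, (b - Pi.single h 1 : ι → ℕ) j = m := by
  have h1 : ∀ j, (b - Pi.single h 1 : ι → ℕ) j + (Pi.single h 1 : ι → ℕ) j = b j := by
    intro j
    by_cases hj : j = h
    · subst hj
      simp
      omega
    · simp [hj]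
  have h2 : ∑ j, (b - Pi.single h 1 : ι → ℕ) j + ∑ j, (Pi.single h 1 : ι → ℕ) j = ∑ j, b j := by
    rw [← sum_add_distrib]
    exact sum_congr rfl fun j _ => h1 j
  simp only [sum_pi_single', mem_univ, if_true] at h2
  omega

theorem ClassificationTree.card_mul_expected_node {k n m : ℕ} (i : Fin n) (t : ComparisonTree k)
    (child : Fin (k + 1) → ClassificationTree k n) {b : Fin (k + 1) → ℕ}
    (hb : ∑ j, b j = m + 1) :
    ((m : ℝ) + 1) * (node i t child).expected b =
      ∑ h, (t.depth h : ℝ) * b h + ∑ h, (b h : ℝ) * (child h).expected (b - Pi.single h 1) := by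
  have hb' : ∑ j, (b j : ℝ) = m + 1 := by exact_mod_cast hb
  rw [expected, hb', mul_div_cancel₀ _ (by positivity), ← sum_add_distrib]
  exact sum_congr rfl fun h _ => by ring

/-! ### Exchangeability -/

/-- A set of inputs that is invariant under permuting the positions in `s`, and in which each input
has `b h` elements of `A_h` at the positions in `s`. -/
structure Exchangeable {n : ℕ} (k : ℕ) (Ω : Finset (Equiv.Perm (Fin n))) (s : Finset (Fin n))
    (b : Fin (k + 1) → ℕ) : Prop where
  subset : s ⊆ nonPivots k n
  mul_swap : ∀ σ ∈ Ω, ∀ i ∈ s, ∀ j ∈ s, σ * Equiv.swap i j ∈ Ω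
  card_eq : ∀ σ ∈ Ω, ∀ h, (s.filter fun i => group k σ i = h).card = b h

theorem mem_nonPivots {k n : ℕ} {i : Fin n} : i ∈ nonPivots k n ↔ k ≤ (i : ℕ) := by
  simp [nonPivots]

/-- Swapping two non-pivot positions leaves the pivots in place. -/
theorem group_mul_swap {k n : ℕ} (σ : Equiv.Perm (Fin n)) {i j : Fin n}
    (hi : i ∈ nonPivots k n) (hj : j ∈ nonPivots k n) (x : Fin n) :
    group k (σ * Equiv.swap i j) x = group k σ (Equiv.swap i j x) := by
  rw [mem_nonPivots] at hi hj
  have : pivotsBelow k (σ * Equiv.swap i j) x = pivotsBelow k σ (Equiv.swap i j x) := by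
    ext y
    rw [pivotsBelow, pivotsBelow, mem_filter, mem_filter]
    simp only [mem_univ, true_and, Equiv.Perm.mul_apply]
    refine and_congr_right fun hy => ?_
    rw [Equiv.swap_apply_of_ne_of_ne (a := i) (b := j) (x := y)]
    · rintro rfl
      omega
    · rintro rfl
      omega
  simp [group, this]

/-- Conditioning on one classified element preserves exchangeability of the rest, so induction can
descend into a subtree. -/
theorem Exchangeable.filter {k n : ℕ} {Ω : Finset (Equiv.Perm (Fin n))} {s : Finset (Fin n)}
    {b : Fin (k + 1) → ℕ} (H : Exchangeable k Ω s b) {i : Fin n} (hi : i ∈ s)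
    (h : Fin (k + 1)) :
    Exchangeable k (Ω.filter fun σ => group k σ i = h) (s.erase i) (b - Pi.single h 1) where
  subset := (erase_subset _ _).trans H.subset
  mul_swap := by
    intro σ hσ x hx y hy
    rw [mem_filter] at hσ ⊢
    rw [mem_erase] at hx hy
    refine ⟨H.mul_swap σ hσ.1 x hx.2 y hy.2, ?_⟩
    rw [group_mul_swap σ (H.subset hx.2) (H.subset hy.2),
      Equiv.swap_apply_of_ne_of_ne hx.1.symm hy.1.symm, hσ.2]
  card_eq := by
    intro σ hσ j
    rw [mem_filter] at hσ
    rw [filter_erase, Pi.sub_apply, ← H.card_eq σ hσ.1 j]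
    by_cases hj : j = h
    · subst hj
      rw [card_erase_of_mem (by simp [hi, hσ.2])]
      simp
    · rw [erase_eq_of_notMem (by simp [hi, hσ.2, Ne.symm hj])]
      simp [hj]

/-- Double counting of the pairs `(σ, j)` with `group k σ j = h`: swaps make the count the same for
every position `j`. -/
theorem Exchangeable.card_filter_mul_card {k n : ℕ} {Ω : Finset (Equiv.Perm (Fin n))}
    {s : Finset (Fin n)} {b : Fin (k + 1) → ℕ} (H : Exchangeable k Ω s b) {i : Fin n}
    (hi : i ∈ s) (h : Fin (k + 1)) :
    (Ω.filter fun σ => group k σ i = h).card * s.card = b h * Ω.card := by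
  have key : ∀ j ∈ s, (Ω.filter fun σ => group k σ j = h).card =
      (Ω.filter fun σ => group k σ i = h).card := by
    intro j hj
    refine card_bij' (fun σ _ => σ * Equiv.swap i j) (fun σ _ => σ * Equiv.swap i j) ?_ ?_ ?_ ?_
    · intro σ hσ
      rw [mem_filter] at hσ ⊢
      refine ⟨H.mul_swap σ hσ.1 i hi j hj, ?_⟩
      rw [group_mul_swap σ (H.subset hi) (H.subset hj), Equiv.swap_apply_left, hσ.2]
    · intro σ hσ
      rw [mem_filter] at hσ ⊢
      refine ⟨H.mul_swap σ hσ.1 i hi j hj, ?_⟩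
      rw [group_mul_swap σ (H.subset hi) (H.subset hj), Equiv.swap_apply_right, hσ.2]
    · intro σ _
      simp [mul_assoc]
    · intro σ _
      simp [mul_assoc]
  have h1 : ∑ j ∈ s, (Ω.filter fun σ => group k σ j = h).card =
      ∑ σ ∈ Ω, (s.filter fun j => group k σ j = h).card := by
    simp only [card_filter]
    exact sum_comm
  rw [sum_congr rfl key, sum_congr rfl fun σ hσ => H.card_eq σ hσ h] at h1
  simp only [sum_const, smul_eq_mul] at h1
  linarith

theorem Exchangeable.sum_comparisons {k n : ℕ} (T : ClassificationTree k n)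
    {Ω : Finset (Equiv.Perm (Fin n))} {s : Finset (Fin n)} {b : Fin (k + 1) → ℕ}
    (H : Exchangeable k Ω s b) (hT : T.Classifies s) (hb : ∑ h, b h = s.card) :
    ∑ σ ∈ Ω, (T.comparisons (group k σ) : ℝ) = Ω.card * T.expected b := by
  induction T generalizing Ω s b with
  | leaf => simp [ClassificationTree.comparisons, ClassificationTree.expected]
  | node i t child ih =>
    obtain ⟨hi, hc⟩ := hT
    obtain ⟨m, hm⟩ : ∃ m, s.card = m + 1 :=
      Nat.exists_eq_succ_of_ne_zero (card_ne_zero_of_mem hi)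
    have hfib : ∀ h, ∑ σ ∈ Ω.filter (fun σ => group k σ i = h),
        (((ClassificationTree.node i t child).comparisons (group k σ) : ℕ) : ℝ) =
        (Ω.filter fun σ => group k σ i = h).card *
          (t.depth h + (child h).expected (b - Pi.single h 1)) := by
      intro h
      have h1 : ∀ σ ∈ Ω.filter (fun σ => group k σ i = h),
          (((ClassificationTree.node i t child).comparisons (group k σ) : ℕ) : ℝ) =
          t.depth h + (child h).comparisons (group k σ) := by
        intro σ hσ
        rw [ClassificationTree.comparisons, (mem_filter.1 hσ).2]
        push_cast
        rfl
      rw [sum_congr rfl h1, sum_add_distrib, sum_const, nsmul_eq_mul, mul_add]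
      congr 1
      -- For `b h = 0` the subtraction truncates and the sizes no longer add up, but then the fiber
      -- is empty.
      by_cases hbh : b h = 0
      · have h2 := H.card_filter_mul_card hi h
        rw [hbh, hm, zero_mul] at h2
        have h3 : Ω.filter (fun σ => group k σ i = h) = ∅ := by
          simpa using h2
        simp [h3]
      · refine ih h (H.filter hi h) (hc h) ?_
        rw [card_erase_of_mem hi, hm, Nat.add_sub_cancel]
        exact sum_sub_single (hb.trans hm) hbh
    have hcard : ∀ h, ((Ω.filter fun σ => group k σ i = h).card : ℝ) =
        b h * Ω.card / (m + 1) := by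
      intro h
      have h2 := H.card_filter_mul_card hi h
      rw [hm] at h2
      rw [eq_div_iff (by positivity)]
      exact_mod_cast h2
    have hb' : ∑ j, (b j : ℝ) = m + 1 := by exact_mod_cast hb.trans hm
    rw [← sum_fiberwise Ω (fun σ => group k σ i), sum_congr rfl fun h _ => hfib h,
      ClassificationTree.expected, hb', mul_div_assoc', mul_sum, sum_div]
    refine sum_congr rfl fun h _ => ?_
    rw [hcard h]
    ring

/-! ### Conditioning on the group sizes -/

theorem sum_groupSizes {k n : ℕ} (σ : Equiv.Perm (Fin n)) :
    ∑ h, groupSizes k σ h = (nonPivots k n).card :=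
  (card_eq_sum_card_fiberwise (f := group k σ) (t := univ) fun _ _ => mem_coe.2 (mem_univ _)).symm

theorem card_nonPivots_add {k n : ℕ} (h : k ≤ n) : (nonPivots k n).card + k = n := by
  have h1 := card_filter_add_card_filter_not (s := (univ : Finset (Fin n)))
    (fun i : Fin n => k ≤ (i : ℕ))
  have h2 : (univ.filter fun i : Fin n => ¬ k ≤ (i : ℕ)).card = k := by
    simp only [not_le, Fin.card_filter_val_lt]
    omega
  rw [h2, card_univ, Fintype.card_fin] at h1
  exact h1

theorem exchangeable_groupSizes {k n : ℕ} (a : Fin (k + 1) → ℕ) :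
    Exchangeable k (univ.filter fun σ : Equiv.Perm (Fin n) => groupSizes k σ = a)
      (nonPivots k n) a where
  subset := Subset.rfl
  mul_swap := by
    intro σ hσ i hi j hj
    rw [mem_filter] at hσ ⊢
    refine ⟨mem_univ _, ?_⟩
    rw [← hσ.2]
    funext h
    have hmem : ∀ x ∈ nonPivots k n, Equiv.swap i j x ∈ nonPivots k n := by
      intro x hx
      rw [Equiv.swap_apply_def]
      split_ifs
      exacts [hj, hi, hx]
    refine card_bij' (fun x _ => Equiv.swap i j x) (fun x _ => Equiv.swap i j x) ?_ ?_ ?_ ?_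
    · intro x hx
      rw [mem_filter] at hx ⊢
      rw [group_mul_swap σ hi hj] at hx
      exact ⟨hmem x hx.1, hx.2⟩
    · intro x hx
      rw [mem_filter] at hx ⊢
      rw [group_mul_swap σ hi hj, Equiv.swap_apply_self]
      exact ⟨hmem x hx.1, hx.2⟩
    · simp
    · simp
  card_eq := by
    intro σ hσ h
    rw [← (mem_filter.1 hσ).2]
    rfl

theorem Strategy.averageCount_le_add {k n : ℕ} (hkn : k ≤ n) (S S' : Strategy k n) (B : ℝ)
    (h : ∀ a : Fin (k + 1) → ℕ, ∑ j, a j + k = n →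
      (S.tree a).expected a ≤ (S'.tree a).expected a + B) :
    S.averageCount ≤ S'.averageCount + B := by
  have hpos : (0 : ℝ) < n.factorial := by exact_mod_cast n.factorial_pos
  have hsum : ∑ σ : Equiv.Perm (Fin n), ((S.tree (groupSizes k σ)).comparisons (group k σ) : ℝ) ≤
      ∑ σ : Equiv.Perm (Fin n),
        (((S'.tree (groupSizes k σ)).comparisons (group k σ) : ℝ) + B) := by
    -- Size vectors form an infinite type, so the fibers are taken over the image.
    have hmaps : ∀ σ ∈ (univ : Finset (Equiv.Perm (Fin n))),
      groupSizes k σ ∈ univ.image (groupSizes k (n := n)) := fun σ _ => mem_image_of_mem _ (mem_univ _)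
    rw [← sum_fiberwise_of_maps_to hmaps, ← sum_fiberwise_of_maps_to hmaps]
    refine sum_le_sum fun a ha => ?_
    obtain ⟨σ₀, -, rfl⟩ := mem_image.1 ha
    set a := groupSizes k σ₀ with ha_def
    have hsz : ∑ j, a j = (nonPivots k n).card := sum_groupSizes σ₀
    have hfib : ∀ R : Strategy k n,
        ∑ σ ∈ univ.filter (fun σ : Equiv.Perm (Fin n) => groupSizes k σ = a),
          ((R.tree (groupSizes k σ)).comparisons (group k σ) : ℝ) =
        (univ.filter (fun σ : Equiv.Perm (Fin n) => groupSizes k σ = a)).card *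
          (R.tree a).expected a := by
      intro R
      rw [← (exchangeable_groupSizes a).sum_comparisons (R.tree a) (R.classifies a) hsz]
      refine sum_congr rfl fun σ hσ => ?_
      rw [(mem_filter.1 hσ).2]
    rw [sum_add_distrib, hfib S, hfib S', sum_const, nsmul_eq_mul, ← mul_add]
    refine mul_le_mul_of_nonneg_left (h a ?_) (Nat.cast_nonneg _)
    rw [hsz, card_nonPivots_add hkn]
  rw [sum_add_distrib, sum_const, card_univ, Fintype.card_perm, Fintype.card_fin,
    nsmul_eq_mul] at hsum
  rw [averageCount, averageCount, div_add' _ _ _ hpos.ne', mul_comm B]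
  exact div_le_div_of_nonneg_right hsum hpos.le

/-! ### The optimal strategy -/

/-- The trees may classify in different orders, so `s` and `s'` differ; only the common `b` matters.
Both roots weight depths by `b`, and equally labeled children again share their sizes. -/
theorem ClassificationTree.expected_le_of_isMinCost {k n : ℕ} (a : Fin (k + 1) → ℕ) (m : ℕ)
    (T T' : ClassificationTree k n) {s s' : Finset (Fin n)} {b u : Fin (k + 1) → ℕ}
    (hT : T.Classifies s) (hT' : T'.Classifies s') (hs : s.card = m) (hs' : s'.card = m)
    (hb : ∑ h, b h = m) (hu : ∀ h, b h + u h = a h)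
    (hO : T.EveryNode (fun t u => t.IsMinCost fun h => (a h : ℤ) - (u h : ℤ)) u) :
    T.expected b ≤ T'.expected b := by
  induction m generalizing T T' s s' b u with
  | zero =>
    rw [card_eq_zero] at hs hs'
    subst hs hs'
    cases T with
    | leaf =>
      cases T' with
      | leaf => exact le_rfl
      | node i t c => exact absurd hT'.1 (notMem_empty _)
    | node i t c => exact absurd hT.1 (notMem_empty _)
  | succ m ih =>
    cases T with
    | leaf =>
      rw [show s = ∅ from hT] at hs
      simp at hs
    | node i t c =>
      cases T' with
      | leaf =>
        rw [show s' = ∅ from hT'] at hs'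
        simp at hs'
      | node i' t' c' =>
        have hm : (0 : ℝ) < (m : ℝ) + 1 := by positivity
        refine le_of_mul_le_mul_left ?_ hm
        rw [card_mul_expected_node i t c hb, card_mul_expected_node i' t' c' hb]
        refine add_le_add ?_ (sum_le_sum fun h _ => ?_)
        · have h1 := hO.1 t'
          have h2 : (fun h => (a h : ℤ) - (u h : ℤ)) = fun h => (b h : ℤ) := by
            funext h
            have := hu h
            omega
          rw [h2] at h1
          simp only [ComparisonTree.cost] at h1
          exact_mod_cast h1
        · by_cases hbh : b h = 0
          · simp [hbh]
          · refine mul_le_mul_of_nonneg_left ?_ (Nat.cast_nonneg _)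
            refine ih (c h) (c' h) (hT.2 h) (hT'.2 h) ?_ ?_ (sum_sub_single hb hbh) ?_ (hO.2 h)
            · rw [card_erase_of_mem hT.1, hs, Nat.add_sub_cancel]
            · rw [card_erase_of_mem hT'.1, hs', Nat.add_sub_cancel]
            · intro j
              have := hu j
              by_cases hj : j = h
              · subst hj
                simp
                omega
              · simpa [hj] using this

/-! ### Minimizing the cost with respect to the full group sizes -/

/-- The sum of the squared deviations of `b` from the multiple `m • p` of `p`. -/
def sqDev {ι : Type*} [Fintype ι] (p b : ι → ℝ) (m : ℝ) : ℝ := ∑ h, (b h - m * p h) ^ 2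

/-- Drawing one of `m` elements at random multiplies the mean squared deviation by `1 - 2 / m`, up
to an additive 2. -/
theorem sum_mul_sqDev_le {ι : Type*} [Fintype ι] [DecidableEq ι] (p b : ι → ℝ) (m : ℝ)
    (hp : ∀ h, 0 ≤ p h) (hp1 : ∑ h, p h ≤ 1) (hb : ∀ h, 0 ≤ b h) (hm : ∑ h, b h = m) :
    ∑ h, b h * sqDev p (b - Pi.single h 1) (m - 1) ≤ m * sqDev p b m - 2 * sqDev p b m + 2 * m := by
  have hin : ∀ h, sqDev p (b - Pi.single h 1) (m - 1) =
      ∑ j, (b j - m * p j + p j) ^ 2 - 2 * (b h - m * p h + p h) + 1 := by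
    intro h
    -- Only coordinate `h` gets the correction, from `(x - 1) ^ 2 = x ^ 2 + (-2 * x + 1)`.
    have h1 : ∀ j, ((b - Pi.single h 1 : ι → ℝ) j - (m - 1) * p j) ^ 2 =
        (b j - m * p j + p j) ^ 2 +
          (Pi.single h (-2 * (b h - m * p h + p h) + 1) : ι → ℝ) j := by
      intro j
      by_cases hj : j = h
      · subst hj
        simp
        ring
      · simp [hj]
        ring
    rw [sqDev, sum_congr rfl fun j _ => h1 j, sum_add_distrib, sum_pi_single']
    simp
    ring
  have hm0 : 0 ≤ m := hm ▸ sum_nonneg fun h _ => hb h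
  have hpp : ∑ h, p h ^ 2 ≤ 1 := by
    refine (sum_le_sum fun h _ => ?_).trans hp1
    have : p h ≤ 1 := (single_le_sum (fun j _ => hp j) (mem_univ h)).trans hp1
    nlinarith [hp h]
  have hbp : 0 ≤ ∑ h, b h * p h := sum_nonneg fun h _ => mul_nonneg (hb h) (hp h)
  have e1 : ∑ h, b h * sqDev p (b - Pi.single h 1) (m - 1) =
      m * ∑ j, (b j - m * p j + p j) ^ 2 +
        ∑ h, (b h * (- 2 * (b h - m * p h + p h)) + b h) := by
    rw [← hm, sum_mul, ← sum_add_distrib, hm]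
    refine sum_congr rfl fun h _ => ?_
    rw [hin h]
    ring
  have e2 : m * ∑ j, (b j - m * p j + p j) ^ 2 +
        ∑ h, (b h * (- 2 * (b h - m * p h + p h)) + b h) =
      m * sqDev p b m - 2 * sqDev p b m + ∑ h, b h + m * ∑ h, p h ^ 2 - 2 * ∑ h, b h * p h := by
    simp only [sqDev, mul_sum, ← sum_add_distrib, ← sum_sub_distrib]
    refine sum_congr rfl fun h _ => ?_
    ring
  rw [e1, e2, hm]
  nlinarith

/-- Depths differ by at most `k`, and `|x| ≤ θ * x ^ 2 + 1 / θ` replaces absolute deviations by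
squares, whose evolution is tractable. -/
theorem ComparisonTree.sum_depth_le_add_sqDev {k : ℕ} (t t' : ComparisonTree k)
    (p b : Fin (k + 1) → ℝ) (m θ : ℝ) (hm : 0 ≤ m) (hθ : 0 < θ)
    (ht : ∑ h, (t.depth h : ℝ) * p h ≤ ∑ h, (t'.depth h : ℝ) * p h) :
    ∑ h, (t.depth h : ℝ) * b h ≤
      ∑ h, (t'.depth h : ℝ) * b h + k * (k + 1) * (θ * sqDev p b m + 1 / θ) := by
  have h1 : ∀ h, ((t.depth h : ℝ) - t'.depth h) * (b h - m * p h) ≤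
      k * (θ * (b h - m * p h) ^ 2 + 1 / θ) := by
    intro h
    have hd : |(t.depth h : ℝ) - t'.depth h| ≤ k := by
      have h1 : (t.depth h : ℝ) ≤ k := by exact_mod_cast t.depth_le h
      have h2 : (t'.depth h : ℝ) ≤ k := by exact_mod_cast t'.depth_le h
      have h3 : (0 : ℝ) ≤ t.depth h := Nat.cast_nonneg _
      have h4 : (0 : ℝ) ≤ t'.depth h := Nat.cast_nonneg _
      rw [abs_le]
      constructor <;> linarith
    have hx : |b h - m * p h| ≤ θ * (b h - m * p h) ^ 2 + 1 / θ := by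
      rw [← sq_abs (b h - m * p h)]
      have hy := abs_nonneg (b h - m * p h)
      set y := |b h - m * p h|
      have : θ * y ^ 2 + 1 / θ - y = ((θ * y - 1) ^ 2 + θ * y) / θ := by
        field_simp
        ring
      have h0 : 0 ≤ ((θ * y - 1) ^ 2 + θ * y) / θ := by positivity
      linarith
    calc _ ≤ |((t.depth h : ℝ) - t'.depth h) * (b h - m * p h)| := le_abs_self _
      _ = |(t.depth h : ℝ) - t'.depth h| * |b h - m * p h| := abs_mul _ _
      _ ≤ _ := mul_le_mul hd hx (abs_nonneg _) (Nat.cast_nonneg _)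
  have h2 := sum_le_sum fun h (_ : h ∈ univ) => h1 h
  have e1 : ∑ h, (k : ℝ) * (θ * (b h - m * p h) ^ 2 + 1 / θ) =
      k * (θ * sqDev p b m + (k + 1) * (1 / θ)) := by
    rw [← mul_sum, sum_add_distrib, ← mul_sum, sqDev]
    simp
  have e2 : ∑ h, ((t.depth h : ℝ) - t'.depth h) * (b h - m * p h) =
      ∑ h, (t.depth h : ℝ) * b h - ∑ h, (t'.depth h : ℝ) * b h -
        m * (∑ h, (t.depth h : ℝ) * p h - ∑ h, (t'.depth h : ℝ) * p h) := by
    rw [← sum_sub_distrib, ← sum_sub_distrib, mul_sum, ← sum_sub_distrib]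
    exact sum_congr rfl fun h _ => by ring
  have h3 : m * (∑ h, (t.depth h : ℝ) * p h - ∑ h, (t'.depth h : ℝ) * p h) ≤ 0 :=
    mul_nonpos_of_nonneg_of_nonpos hm (sub_nonpos.2 ht)
  -- Slack that gives both error terms the common factor `k * (k + 1)`.
  have h4 : 0 ≤ (k : ℝ) * (k * (θ * sqDev p b m)) := by
    have : 0 ≤ sqDev p b m := sum_nonneg fun h _ => sq_nonneg _
    positivity
  rw [e1, e2] at h2
  linarith

/-- The error is a potential. With `m` elements left the root loses `(θ * sqDev + 1 / θ) / m`, up to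
the factor `k * (k + 1)`. The contraction by `1 - 2 / m` pays for the `sqDev` part out of `sqDev /
2`; the drift costs `θ` per step, and the terms `1 / (θ * m)` add up to `harmonic m / θ`. -/
theorem ClassificationTree.expected_le_add {k n : ℕ} (p : Fin (k + 1) → ℝ)
    (hp : ∀ h, 0 ≤ p h) (hp1 : ∑ h, p h ≤ 1) (θ : ℝ) (hθ : 0 < θ)
    (P : ComparisonTree k → Prop)
    (hP : ∀ t t' : ComparisonTree k, P t → ∑ h, (t.depth h : ℝ) * p h ≤ ∑ h, (t'.depth h : ℝ) * p h) (m : ℕ)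
    (T T' : ClassificationTree k n) {s s' : Finset (Fin n)} {b u : Fin (k + 1) → ℕ}
    (hT : T.Classifies s) (hT' : T'.Classifies s') (hs : s.card = m) (hs' : s'.card = m)
    (hb : ∑ h, b h = m) (hN : T.EveryNode (fun t _ => P t) u) :
    T.expected b ≤ T'.expected b + k * (k + 1) *
      (θ * (sqDev p (fun h => (b h : ℝ)) m / 2 + m) + (harmonic m : ℝ) / θ) := by
  induction m generalizing T T' s s' b u with
  | zero =>
    have h0 : 0 ≤ sqDev p (fun h => (b h : ℝ)) ((0 : ℕ) : ℝ) := sum_nonneg fun h _ => sq_nonneg _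
    rw [card_eq_zero] at hs hs'
    subst hs hs'
    cases T with
    | leaf =>
      cases T' with
      | leaf =>
        simp only [expected, harmonic_zero]
        push_cast at h0 ⊢
        rw [zero_add, zero_div]
        positivity
      | node i t c => exact absurd hT'.1 (notMem_empty _)
    | node i t c => exact absurd hT.1 (notMem_empty _)
  | succ m ih =>
    cases T with
    | leaf =>
      rw [show s = ∅ from hT] at hs
      simp at hs
    | node i t c =>
      cases T' with
      | leaf =>
        rw [show s' = ∅ from hT'] at hs'
        simp at hs'
      | node i' t' c' =>
        have hm : (0 : ℝ) < (m : ℝ) + 1 := by positivity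
        refine le_of_mul_le_mul_left ?_ hm
        rw [mul_add, card_mul_expected_node i t c hb, card_mul_expected_node i' t' c' hb]
        have hb' : ∑ j, (b j : ℝ) = (m : ℝ) + 1 := by exact_mod_cast hb
        set β : Fin (k + 1) → ℝ := fun h => (b h : ℝ) with hβ
        have hroot := t.sum_depth_le_add_sqDev t' p β (m + 1) θ hm.le hθ (hP t t' hN.1)
        have hchild : ∀ h, (b h : ℝ) * (c h).expected (b - Pi.single h 1) ≤
            (b h : ℝ) * (c' h).expected (b - Pi.single h 1) +
            k * (k + 1) * (θ / 2 * (β h * sqDev p (β - Pi.single h 1) (m + 1 - 1)) +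
              (θ * m + harmonic m / θ) * β h) := by
          intro h
          by_cases hbh : b h = 0
          · simp [hbh, hβ]
          · have h1 := ih (c h) (c' h) (hT.2 h) (hT'.2 h)
              (by rw [card_erase_of_mem hT.1, hs, Nat.add_sub_cancel])
              (by rw [card_erase_of_mem hT'.1, hs', Nat.add_sub_cancel])
              (sum_sub_single hb hbh) (hN.2 h)
            have h2 : (fun j => (((b - Pi.single h 1 : Fin (k + 1) → ℕ) j : ℕ) : ℝ)) = β - Pi.single h 1 := by
              funext j
              by_cases hj : j = h
              · subst hj
                simp [hβ, Nat.cast_sub (Nat.one_le_iff_ne_zero.2 hbh)]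
              · simp [hβ, hj]
            rw [h2] at h1
            rw [add_sub_cancel_right]
            calc _ ≤ _ := mul_le_mul_of_nonneg_left h1 (Nat.cast_nonneg (b h))
              _ = _ := by
                simp only [hβ]
                ring
        have hsum := sum_le_sum fun h (_ : h ∈ univ) => hchild h
        rw [sum_add_distrib, ← mul_sum, sum_add_distrib, ← mul_sum, ← mul_sum, hb'] at hsum
        have hQ := sum_mul_sqDev_le p β (m + 1) hp hp1 (fun h => Nat.cast_nonneg _) hb'
        have hK : (0 : ℝ) ≤ k * (k + 1) * (θ / 2) := by positivity
        have hQ' := mul_le_mul_of_nonneg_left hQ hK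
        rw [harmonic_succ]
        push_cast
        have e : ((m : ℝ) + 1) * (k * (k + 1) * (θ * (sqDev p β (m + 1) / 2 + (m + 1)) +
              ((harmonic m : ℝ) + ((m : ℝ) + 1)⁻¹) / θ)) =
            k * (k + 1) * (θ * sqDev p β (m + 1) + 1 / θ) +
            (k * (k + 1) * (θ / 2) * ((m + 1) * sqDev p β (m + 1) - 2 * sqDev p β (m + 1)
                + 2 * (m + 1)) +
              k * (k + 1) * ((θ * m + harmonic m / θ) * (m + 1))) := by
          field_simp
          ring
        rw [e]
        linarith

theorem ClassificationTree.expected_le_add_of_isMinCost {k n m : ℕ} (a : Fin (k + 1) → ℕ)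
    (θ : ℝ) (hθ : 0 < θ) (T T' : ClassificationTree k n) {s : Finset (Fin n)}
    (hT : T.Classifies s) (hT' : T'.Classifies s) (hs : s.card = m) (ha : ∑ h, a h = m)
    (hN : T.EveryNode (fun t _ => t.IsMinCost fun h => (a h : ℤ)) 0) :
    T.expected a ≤ T'.expected a + k * (k + 1) * (θ * m + (harmonic m : ℝ) / θ) := by
  have ha' : ∑ h, (a h : ℝ) = m := by exact_mod_cast ha
  have h := expected_le_add (fun h => (a h : ℝ) / m) (fun h => by positivity)
    -- For `m = 0` the weights `a h / m` are all 0, hence `≤ 1` instead of `= 1`.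
    (by rw [← sum_div, ha']; exact div_self_le_one _) θ hθ
    (fun t => t.IsMinCost fun h => (a h : ℤ)) (fun t t' ht => ?_) m T T' hT hT' hs hs ha hN
  · have h0 : sqDev (fun h => (a h : ℝ) / m) (fun h => (a h : ℝ)) m = 0 := by
      refine sum_eq_zero fun h _ => ?_
      rcases Nat.eq_zero_or_pos m with hm | hm
      · have : a h = 0 := by
          rw [hm, sum_eq_zero_iff] at ha
          exact ha h (mem_univ h)
        simp [this]
      · field_simp
        simp
    rwa [h0, zero_div, zero_add] at h
  · have h1 := ht t'
    simp only [ComparisonTree.cost] at h1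
    have h2 : ∑ h, (t.depth h : ℝ) * a h ≤ ∑ h, (t'.depth h : ℝ) * a h := by exact_mod_cast h1
    simp only [mul_div_assoc', ← sum_div]
    exact div_le_div_of_nonneg_right h2 (Nat.cast_nonneg _)

/-! ### Choice of `θ` and conclusion -/

/-- The choice `θ = n ^ (-1/2)` balances both terms up to a logarithm, which is absorbed by `log n ≤
4 * n ^ (1/4)`; the constant is `6 = 1 + 1 + 4`. -/
theorem rpow_mul_add_harmonic_div_le {m n : ℕ} (hmn : m ≤ n) (hn : 1 ≤ n) :
    (n : ℝ) ^ (-(1 / 2) : ℝ) * m + (harmonic m : ℝ) / (n : ℝ) ^ (-(1 / 2) : ℝ) ≤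
      6 * (n : ℝ) ^ (1 - 1 / 4 : ℝ) := by
  have hn1 : (1 : ℝ) ≤ n := by exact_mod_cast hn
  have hn0 : (0 : ℝ) < n := by linarith
  have hmn' : (m : ℝ) ≤ n := by exact_mod_cast hmn
  have hharm : (harmonic m : ℝ) ≤ 1 + 4 * (n : ℝ) ^ (1 / 4 : ℝ) := by
    have h1 : (harmonic m : ℝ) ≤ harmonic n := by
      simp only [harmonic]
      exact_mod_cast sum_le_sum_of_subset_of_nonneg (range_mono hmn)
        fun i _ _ => by positivity
    have h2 := harmonic_le_one_add_log n
    have h3 := Real.log_le_rpow_div hn0.le (show (0 : ℝ) < 1 / 4 by norm_num)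
    linarith
  have e1 : (n : ℝ) ^ (-(1 / 2) : ℝ) * n = (n : ℝ) ^ (1 / 2 : ℝ) := by
    rw [← Real.rpow_add_one hn0.ne']
    norm_num
  have e2 : (n : ℝ) ^ (1 / 4 : ℝ) * (n : ℝ) ^ (1 / 2 : ℝ) = (n : ℝ) ^ (1 - 1 / 4 : ℝ) := by
    rw [← Real.rpow_add hn0]
    norm_num
  have h4 : (n : ℝ) ^ (1 / 2 : ℝ) ≤ (n : ℝ) ^ (1 - 1 / 4 : ℝ) :=
    Real.rpow_le_rpow_of_exponent_le hn1 (by norm_num)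
  have h5 : 0 ≤ (n : ℝ) ^ (1 / 2 : ℝ) := by positivity
  have h6 : (n : ℝ) ^ (-(1 / 2) : ℝ) * m ≤ (n : ℝ) ^ (-(1 / 2) : ℝ) * n :=
    mul_le_mul_of_nonneg_left hmn' (by positivity)
  have h7 := mul_le_mul_of_nonneg_right hharm h5
  rw [Real.rpow_neg hn0.le, div_inv_eq_mul, ← Real.rpow_neg hn0.le]
  linarith

end MultiPivot

/-- For every number `k` of pivots, strategy `N_k` is asymptotically optimal: its average comparison
count differs by at most `O(n^(1-ε))` from that of the optimal strategy `O_k`, and it exceeds the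
average comparison count of no classification strategy by more than `O(n^(1-ε))`. -/
theorem mainTheorem5 (k : ℕ) (hk : 1 ≤ k) :
    ∃ ε : ℝ, 0 < ε ∧ ∃ C : ℝ, ∀ n : ℕ, k ≤ n →
      ∀ N : MultiPivot.Strategy k n, N.IsN →
        (∀ O : MultiPivot.Strategy k n, O.IsO →
          |N.averageCount - O.averageCount| ≤ C * (n : ℝ) ^ (1 - ε)) ∧
        (∀ S : MultiPivot.Strategy k n,
          N.averageCount ≤ S.averageCount + C * (n : ℝ) ^ (1 - ε)) := by
  refine ⟨1 / 4, by norm_num, k * (k + 1) * 6, fun n hkn N hN => ?_⟩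
  have hcard := MultiPivot.card_nonPivots_add hkn
  have hn : 1 ≤ n := hk.trans hkn
  have hle : ∀ S : MultiPivot.Strategy k n,
      N.averageCount ≤ S.averageCount + k * (k + 1) * 6 * (n : ℝ) ^ (1 - 1 / 4 : ℝ) := by
    intro S
    refine N.averageCount_le_add hkn S _ fun a ha => ?_
    refine (MultiPivot.ClassificationTree.expected_le_add_of_isMinCost a _
      (Real.rpow_pos_of_pos (Nat.cast_pos.2 hn) (-(1 / 2))) _ (S.tree a) (N.classifies a)
      (S.classifies a) rfl (by omega) (hN a ha)).trans ?_
    rw [mul_assoc _ (6 : ℝ)]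
    gcongr
    exact MultiPivot.rpow_mul_add_harmonic_div_le (by omega) hn
  refine ⟨fun O hO => ?_, hle⟩
  -- Optimality of `O` fixes the sign inside the absolute value.
  have hge : O.averageCount ≤ N.averageCount + 0 := by
    refine O.averageCount_le_add hkn N 0 fun a ha => ?_
    rw [add_zero]
    exact MultiPivot.ClassificationTree.expected_le_of_isMinCost a _ _ _ (O.classifies a)
      (N.classifies a) rfl rfl (by omega) (fun h => by simp) (hO a ha)
  rw [abs_of_nonneg (by linarith)]
  linarith [hle O]
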